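/- **Setting.** Let $d\in\{2,3\}$ and let $\Omega\subset\mathbb R^d$ be a nonempty bounded convex polygonal/polyhedral open domain. Let $(\cdot,\cdot)$ and $\|\cdot\|$ be the inner product and norm of $L^2(\Omega)$ (for scalar, vector and matrix fields), $X=H_0^1(\Omega)^d$, $b(u,v,w)=(u\cdot\nabla v,w)$, and for $f\in H^{-1}(\Omega)^d=X^*$ let $\|f\|_{-1}=\sup_{0\neq\varphi\in X}|\langle f,\varphi\rangle|/\|\nabla\varphi\|$. There is a constant $C>0$ depending only on $\Omega$ such that $$|b(u,v,w)|\le C\,\|\nabla u\|\,\|\nabla v\|\,\|\nabla w\|\qquad\text{for all }u,v,w\in X;\tag{1}$$ let $C>0$ be any constant satisfying (1). Let $\tau_h$ be a conforming simplicial triangulation of $\overline\Omega$ with maximal cell diameter $h$, and let $k\ge 1$. Let $X_h\subset X$ be the fields in $X$ that are polynomial of degree $\le k$ on each cell, let $Q_h\subset L^2_0(\Omega)$ be the (possibly discontinuous) mean-zero functions that are polynomial of degree $\le k-1$ on each cell, and let $V_h=\{v\in X_h:(\nabla\cdot v,q)=0\ \ \forall q\in Q_h\}$. Assume the inverse inequality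 $\|\nabla\chi\|\le C_i h^{-1}\|\chi\|$ for all $\chi\in X_h$, with $C_i>0$. Let $\nu,\nu_m>0$, $T,\Delta t>0$, $M=T/\Delta t\in\mathbb N$, $t^n=n\Delta t$, $J\ge1$, and let $f_{1,j},f_{2,j}$ be $H^{-1}(\Omega)^d$-valued functions of time, $1\le j\le J$. For sequences $(u_j^n)$ put $$\langle u\rangle^n=\frac1J\sum_{j=1}^J(2u_j^n-u_j^{n-1}),\qquad u_j'^{\,n}=2u_j^n-u_j^{n-1}-\langle u\rangle^n .$$ Let $v_j^n,w_j^n\in V_h$ ($0\le n\le M$, $1\le j\le J$) be computed from given $v_j^0,v_j^1,w_j^0,w_j^1\in V_h$ by the BDF2 Elsässer ensemble scheme: for $n=1,\dots,M-1$, all $j$ and all $\chi,l\in V_h$, $$\Big(\tfrac{3v_j^{n+1}-4v_j^n+v_j^{n-1}}{2\Delta t},\chi\Big)+\tfrac{\nu+\nu_m}2(\nabla v_j^{n+1},\nabla\chi)+\tfrac{\nu-\nu_m}2(\nabla(2w_j^n-w_j^{n-1}),\nabla\chi)+b(\langle w\rangle^n,v_j^{n+1},\chi)+b(w_j'^{\,n},2v_j^n-v_j^{n-1},\chi)=\langle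 f_{1,j}(t^{n+1}),\chi\rangle,$$ $$\Big(\tfrac{3w_j^{n+1}-4w_j^n+w_j^{n-1}}{2\Delta t},l\Big)+\tfrac{\nu+\nu_m}2(\nabla w_j^{n+1},\nabla l)+\tfrac{\nu-\nu_m}2(\nabla(2v_j^n-v_j^{n-1}),\nabla l)+b(\langle v\rangle^n,w_j^{n+1},l)+b(v_j'^{\,n},2w_j^n-w_j^{n-1},l)=\langle f_{2,j}(t^{n+1}),l\rangle .$$ **Stability lemma.** Let $\alpha=\nu+\nu_m-|\nu-\nu_m|$, which is positive. If, for $n=1,\dots,M-1$, $$\Delta t\le\frac{\alpha h^2}{3(\nu-\nu_m)^2C_i^2+12\,C^2C_i^2\max_{1\le j\le J}\max\{\|\nabla v_j'^{\,n}\|^2,\|\nabla w_j'^{\,n}\|^2\}}$$ (no restriction for those $n$ for which the denominator is $0$), then the scheme is stable: for every $j=1,\dots,J$, $$\|v_j^M\|^2+\|w_j^M\|^2+\|2v_j^M-v_j^{M-1}\|^2+\|2w_j^M-w_j^{M-1}\|^2+\alpha\Delta t\sum_{n=1}^{M-1}\big(\|\nabla v_j^{n+1}\|^2+\|\nabla w_j^{n+1}\|^2\big)$$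 $$\le\|v_j^1\|^2+\|w_j^1\|^2+\|2v_j^1-v_j^0\|^2+\|2w_j^1-w_j^0\|^2+\frac{12\Delta t}{\alpha}\sum_{n=1}^{M-1}\big(\|f_{1,j}(t^{n+1})\|_{-1}^2+\|f_{2,j}(t^{n+1})\|_{-1}^2\big).$$ -/

import Mathlib

open MeasureTheory
open scoped ContDiff

noncomputable section

namespace MHDEnsemble

/-- The Euclidean space `ℝ^d`. -/
abbrev E (d : ℕ) : Type := EuclideanSpace ℝ (Fin d)

/-- Real `d × d` matrices with the Frobenius inner product. -/
abbrev Mat (d : ℕ) : Type := EuclideanSpace ℝ (Fin d × Fin d)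

/-- Vector fields in `L²(Ω)^d`. -/
abbrev L2Vec {d : ℕ} (Ω : Set (E d)) : Type := Lp (E d) 2 (volume.restrict Ω)

/-- Matrix fields in `L²(Ω)^{d×d}`. -/
abbrev L2Mat {d : ℕ} (Ω : Set (E d)) : Type := Lp (Mat d) 2 (volume.restrict Ω)

/-- Scalar functions in `L²(Ω)`. -/
abbrev L2 {d : ℕ} (Ω : Set (E d)) : Type := Lp ℝ 2 (volume.restrict Ω)

/-- The Jacobian of a differentiable vector field; the entry `(i, j)` is `∂_j φ_i`. -/
def jacobian {d : ℕ} (φ : E d → E d) (x : E d) : Mat d :=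
  WithLp.toLp 2 fun ij => fderiv ℝ φ x (EuclideanSpace.single ij.2 1) ij.1

/-- The pairs `(φ, ∇φ)` with `φ` a smooth vector field with compact support in `Ω`. -/
def testGraph {d : ℕ} (Ω : Set (E d)) : Set (WithLp 2 (L2Vec Ω × L2Mat Ω)) :=
  {p | ∃ φ : E d → E d, ContDiff ℝ ∞ φ ∧ HasCompactSupport φ ∧ tsupport φ ⊆ Ω ∧
    p.fst =ᵐ[volume.restrict Ω] φ ∧ p.snd =ᵐ[volume.restrict Ω] jacobian φ}

/-- The space `X = H¹₀(Ω)^d`, the closure of the smooth compactly supported fields in the `H¹` norm.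
An element is stored as the pair `(u, ∇u)` of the field and its weak gradient, which is determined
by `u`; the norm is `(‖u‖² + ‖∇u‖²)^{1/2}`. -/
def H10 {d : ℕ} (Ω : Set (E d)) : Submodule ℝ (WithLp 2 (L2Vec Ω × L2Mat Ω)) :=
  (Submodule.span ℝ (testGraph Ω)).topologicalClosure

/-- The field `u ∈ L²(Ω)^d` underlying an element of `H¹₀(Ω)^d`. -/
def field {d : ℕ} {Ω : Set (E d)} (u : H10 Ω) : L2Vec Ω := u.1.fst

/-- The weak gradient `∇u ∈ L²(Ω)^{d×d}` of an element of `H¹₀(Ω)^d`; entry `(i, j)` is `∂_j u_i`. -/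
def grad {d : ℕ} {Ω : Set (E d)} (u : H10 Ω) : L2Mat Ω := u.1.snd

/-- The divergence `x ↦ ∑ i, ∂_i u_i x` of an element of `H¹₀(Ω)^d`. -/
def divergence {d : ℕ} {Ω : Set (E d)} (u : H10 Ω) (x : E d) : ℝ := ∑ i, grad u x (i, i)

/-- `b(u, v, w) = (u · ∇v, w)`. -/
def b {d : ℕ} {Ω : Set (E d)} (u v w : H10 Ω) : ℝ :=
  ∫ x in Ω, ∑ i, (∑ j, field u x j * grad v x (i, j)) * field w x i

/-- `C` is an admissible constant in `|b(u, v, w)| ≤ C ‖∇u‖ ‖∇v‖ ‖∇w‖` on `H¹₀(Ω)^d`. -/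
def IsConvectionConstant {d : ℕ} (Ω : Set (E d)) (C : ℝ) : Prop :=
  0 < C ∧ ∀ u v w : H10 Ω, |b u v w| ≤ C * ‖grad u‖ * ‖grad v‖ * ‖grad w‖

/-- `H^{-1}(Ω)^d`, the dual of `H¹₀(Ω)^d`. -/
abbrev HNeg {d : ℕ} (Ω : Set (E d)) : Type := H10 Ω →L[ℝ] ℝ

/-- The norm `‖f‖_{-1} = sup_{φ ≠ 0} |⟨f, φ⟩| / ‖∇φ‖`. -/
def negNorm {d : ℕ} {Ω : Set (E d)} (f : HNeg Ω) : ℝ :=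
  ⨆ φ : H10 Ω, |f φ| / ‖grad φ‖

/-- A (conforming, simplicial) triangulation of `Ω`: a finite simplicial complex, all of whose
maximal faces are `d`-simplices, with union the closure of `Ω`. -/
structure Triangulation {d : ℕ} (Ω : Set (E d)) where
  complex : Geometry.SimplicialComplex ℝ (E d)
  finite : complex.faces.Finite
  pure : ∀ s ∈ complex.facets, s.card = d + 1
  space_eq : complex.space = closure Ω

/-- The maximal diameter `h` of the cells of a triangulation. -/
def Triangulation.meshSize {d : ℕ} {Ω : Set (E d)} (𝒯 : Triangulation Ω) : ℝ :=
  sSup ((fun s : Finset (E d) => Metric.diam (convexHull ℝ (s : Set (E d)))) '' 𝒯.complex.facets)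

/-- `g` coincides a.e. on each cell with a polynomial of degree at most `k`. -/
def Triangulation.IsPiecewisePoly {d : ℕ} {Ω : Set (E d)} (𝒯 : Triangulation Ω) (k : ℕ)
    (g : E d → ℝ) : Prop :=
  ∀ s ∈ 𝒯.complex.facets, ∃ p : MvPolynomial (Fin d) ℝ, p.totalDegree ≤ k ∧
    ∀ᵐ x ∂(volume.restrict Ω), x ∈ convexHull ℝ (s : Set (E d)) →
      g x = MvPolynomial.eval (fun i => x i) p

/-- The velocity space `X_h`: the elements of `H¹₀(Ω)^d` that are piecewise polynomial of degree at
most `k` (for such functions, membership in `H¹` amounts to continuity across the cells). -/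
def velocitySpace {d : ℕ} {Ω : Set (E d)} (𝒯 : Triangulation Ω) (k : ℕ) : Set (H10 Ω) :=
  {u | ∀ i, 𝒯.IsPiecewisePoly k fun x => field u x i}

/-- The pressure space `Q_h`: the (in general discontinuous) piecewise polynomials of degree at
most `k - 1` in `L²₀(Ω)`. -/
def pressureSpace {d : ℕ} {Ω : Set (E d)} (𝒯 : Triangulation Ω) (k : ℕ) : Set (L2 Ω) :=
  {q | ∫ x in Ω, q x = 0 ∧ 𝒯.IsPiecewisePoly (k - 1) q}

/-- The space `V_h` of discretely divergence free elements of `X_h`. -/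
def discreteDivFree {d : ℕ} {Ω : Set (E d)} (𝒯 : Triangulation Ω) (k : ℕ) : Set (H10 Ω) :=
  {v | v ∈ velocitySpace 𝒯 k ∧ ∀ q ∈ pressureSpace 𝒯 k, ∫ x in Ω, divergence v x * q x = 0}

/-- The inverse inequality `‖∇χ‖ ≤ C_i h⁻¹ ‖χ‖` on `X_h`. -/
def InverseInequality {d : ℕ} {Ω : Set (E d)} (𝒯 : Triangulation Ω) (k : ℕ) (Ci : ℝ) : Prop :=
  ∀ χ ∈ velocitySpace 𝒯 k, ‖grad χ‖ ≤ Ci / 𝒯.meshSize * ‖field χ‖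

/-- The extrapolation `2 u^n - u^{n-1}`, for `n ≥ 1`. -/
def extrap {d : ℕ} {Ω : Set (E d)} (u : ℕ → H10 Ω) (n : ℕ) : H10 Ω :=
  (2 : ℝ) • u n - u (n - 1)

/-- The ensemble mean `<u>^n = (1/J) ∑_j (2 u_j^n - u_j^{n-1})`. -/
def ensembleMean {d J : ℕ} {Ω : Set (E d)} (u : Fin J → ℕ → H10 Ω) (n : ℕ) : H10 Ω :=
  (1 / (J : ℝ)) • ∑ j, extrap (u j) n

/-- The fluctuation `u_j'^n = 2 u_j^n - u_j^{n-1} - <u>^n`. -/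
def fluctuation {d J : ℕ} {Ω : Set (E d)} (u : Fin J → ℕ → H10 Ω) (j : Fin J) (n : ℕ) : H10 Ω :=
  extrap (u j) n - ensembleMean u n

/-- One step `n → n + 1` of the scheme for one of the two unknowns `a` (the other one being `c`):
`((3 a_j^{n+1} - 4 a_j^n + a_j^{n-1}) / (2Δt), χ) + (ν+ν_m)/2 (∇a_j^{n+1}, ∇χ)
  + (ν-ν_m)/2 (∇(2 c_j^n - c_j^{n-1}), ∇χ) + (<c>^n · ∇a_j^{n+1}, χ)
  + (c_j'^n · ∇(2 a_j^n - a_j^{n-1}), χ) = ⟨f, χ⟩` for all `χ ∈ V`. -/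
def IsStep {d J : ℕ} {Ω : Set (E d)} (V : Set (H10 Ω)) (ν νm Δt : ℝ) (f : HNeg Ω)
    (a c : Fin J → ℕ → H10 Ω) (j : Fin J) (n : ℕ) : Prop :=
  ∀ χ ∈ V,
    inner ℝ ((1 / (2 * Δt)) •
        ((3 : ℝ) • field (a j (n + 1)) - (4 : ℝ) • field (a j n) + field (a j (n - 1)))) (field χ)
      + (ν + νm) / 2 * inner ℝ (grad (a j (n + 1))) (grad χ)
      + (ν - νm) / 2 * inner ℝ (grad (extrap (c j) n)) (grad χ)
      + b (ensembleMean c n) (a j (n + 1)) χ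
      + b (fluctuation c j n) (extrap (a j) n) χ
    = f χ

/-- `(v, w)` is an output of the fully discrete BDF2 ensemble algorithm with `M` time steps: all
iterates lie in `V_h`, and both equations hold at the steps `n = 1, …, M - 1`, the forcings being
evaluated at `t^{n+1} = (n + 1) Δt`. -/
structure IsEnsembleSolution {d J : ℕ} {Ω : Set (E d)} (𝒯 : Triangulation Ω) (k : ℕ)
    (ν νm Δt : ℝ) (M : ℕ) (f₁ f₂ : Fin J → ℝ → HNeg Ω) (v w : Fin J → ℕ → H10 Ω) : Prop where
  mem_v : ∀ j, ∀ n ≤ M, v j n ∈ discreteDivFree 𝒯 k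
  mem_w : ∀ j, ∀ n ≤ M, w j n ∈ discreteDivFree 𝒯 k
  step_v : ∀ j, ∀ n ∈ Finset.Icc 1 (M - 1),
    IsStep (discreteDivFree 𝒯 k) ν νm Δt (f₁ j ((n + 1 : ℕ) * Δt)) v w j n
  step_w : ∀ j, ∀ n ∈ Finset.Icc 1 (M - 1),
    IsStep (discreteDivFree 𝒯 k) ν νm Δt (f₂ j ((n + 1 : ℕ) * Δt)) w v j n

/-- `α = ν + ν_m - |ν - ν_m|`. -/
def alpha (ν νm : ℝ) : ℝ := ν + νm - |ν - νm|

/-- The time step restriction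
`Δt ≤ α h² / (3 (ν-ν_m)² C_i² + 12 C² C_i² max_j {‖∇v_j'^n‖², ‖∇w_j'^n‖²})` for `n = 1, …, M - 1`,
with the denominator multiplied out, so that it is void where the denominator vanishes. -/
def TimeStepRestriction {d J : ℕ} {Ω : Set (E d)} (ν νm C Ci h Δt : ℝ) (M : ℕ)
    (v w : Fin J → ℕ → H10 Ω) : Prop :=
  ∀ n ∈ Finset.Icc 1 (M - 1),
    Δt * (3 * (ν - νm) ^ 2 * Ci ^ 2 + 12 * C ^ 2 * Ci ^ 2 *
      ⨆ j, max (‖grad (fluctuation v j n)‖ ^ 2) (‖grad (fluctuation w j n)‖ ^ 2))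
    ≤ alpha ν νm * h ^ 2

end MHDEnsemble

end

noncomputable section

namespace MHDEnsemble

open scoped NNReal ENNReal

variable {d : ℕ} {Ω : Set (E d)}

/-! Each equation is tested with its own newest iterate A = a^{n+1}. After multiplication by 4Δt the
BDF2 quotient becomes an increment of the energy plus ‖δ‖², where δ = A - (2a^n - a^{n-1})
(`inner_bdf2`). This square has to pay for everything treated explicitly. Convection by the ensemble
mean drops out, and writing the extrapolation as A - δ in the fluctuation term leaves only -b(c', δ,
A). Estimate (1), the inverse inequality and Young's inequality bound it by a share of α‖∇A‖² and a
multiple of ‖δ‖². The lagged cross-viscosity term is handled likewise, with the δ of the other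
unknown, so the time step restriction absorbs both multiples only once the two equations are added
(`energy_step_le`, `energy_pair_step_le`). Summation over n telescopes.

The form b is not skew-symmetrised, so b(u, v, v) = 0 requires div u to vanish exactly. It does on
V_h: the divergence of a field in X_h lies in Q_h and is therefore an admissible pressure test
function (`divergence_ae_eq_zero`, `b_self_eq_zero`).

A constant C exists by Hölder's inequality with exponents 4, 4, 2 and the embedding of H¹₀ in L⁴
(`eLpNorm_four_field_le`). The same embedding yields the Poincaré inequality behind the dual norm
estimate. -/

/-! ### Density of test fields in H¹₀ -/

theorem jacobian_apply (φ : E d → E d) (x : E d) (i j : Fin d) :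
    jacobian φ x (i, j) = fderiv ℝ φ x (EuclideanSpace.single j 1) i := rfl

theorem jacobian_add {φ ψ : E d → E d} (hφ : Differentiable ℝ φ) (hψ : Differentiable ℝ ψ) :
    jacobian (φ + ψ) = jacobian φ + jacobian ψ := by
  ext x ⟨i, j⟩
  simp [jacobian_apply, fderiv_add (hφ x) (hψ x)]

theorem jacobian_const_smul {φ : E d → E d} (c : ℝ) (hφ : Differentiable ℝ φ) :
    jacobian (c • φ) = c • jacobian φ := by
  ext x ⟨i, j⟩
  simp [jacobian_apply, fderiv_const_smul (hφ x)]

/-- The test graph as a linear subspace. -/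
def testSubmodule (Ω : Set (E d)) : Submodule ℝ (WithLp 2 (L2Vec Ω × L2Mat Ω)) where
  carrier := testGraph Ω
  zero_mem' := by
    refine ⟨0, contDiff_const, HasCompactSupport.zero, by simp, ?_, ?_⟩
    · exact Lp.coeFn_zero _ _ _
    · refine (Lp.coeFn_zero _ _ _).trans (Filter.Eventually.of_forall fun x => ?_)
      ext ⟨i, j⟩
      simp [jacobian_apply]
  add_mem' := by
    rintro p q ⟨φ, h1, h2, h3, h4, h5⟩ ⟨ψ, g1, g2, g3, g4, g5⟩
    refine ⟨φ + ψ, h1.add g1, h2.add g2,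
      (tsupport_add φ ψ).trans (Set.union_subset h3 g3), ?_, ?_⟩
    · exact (Lp.coeFn_add p.fst q.fst).trans (h4.add g4)
    · rw [jacobian_add (h1.differentiable (by simp)) (g1.differentiable (by simp))]
      exact (Lp.coeFn_add p.snd q.snd).trans (h5.add g5)
  smul_mem' := by
    rintro c p ⟨φ, h1, h2, h3, h4, h5⟩
    refine ⟨c • φ, contDiff_const.smul h1, h2.smul_left (f := fun _ => c),
      (tsupport_smul_subset_right (fun _ => c) φ).trans h3, ?_, ?_⟩
    · exact (Lp.coeFn_smul c p.fst).trans (h4.const_smul c)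
    · rw [jacobian_const_smul c (h1.differentiable (by simp))]
      exact (Lp.coeFn_smul c p.snd).trans (h5.const_smul c)

/-- Test pairs already form a subspace, so the span adds nothing. Approximants of an element of H¹₀
can thus be taken to be single test fields. -/
theorem H10_eq_closure : H10 Ω = (testSubmodule Ω).topologicalClosure := by
  have h : Submodule.span ℝ (testGraph Ω) = testSubmodule Ω :=
    Submodule.span_eq (testSubmodule Ω)
  rw [H10, h]

/-- Elements of `H¹₀` are limits of smooth compactly supported fields. -/
theorem exists_seq_test (u : H10 Ω) : ∃ s : ℕ → H10 Ω,
    (∀ n, (s n : WithLp 2 (L2Vec Ω × L2Mat Ω)) ∈ testGraph Ω) ∧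
      Filter.Tendsto s Filter.atTop (nhds u) := by
  have hu : (u : WithLp 2 (L2Vec Ω × L2Mat Ω)) ∈ closure (testSubmodule Ω : Set _) := by
    have h : (u : WithLp 2 (L2Vec Ω × L2Mat Ω)) ∈ (testSubmodule Ω).topologicalClosure := by
      rw [← H10_eq_closure]
      exact u.2
    exact h
  obtain ⟨s, hs, hlim⟩ := mem_closure_iff_seq_limit.1 hu
  have hmem : ∀ n, s n ∈ H10 Ω := fun n => by
    rw [H10_eq_closure]
    exact (testSubmodule Ω).le_topologicalClosure (hs n)
  exact ⟨fun n => ⟨s n, hmem n⟩, hs, tendsto_subtype_rng.2 hlim⟩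

/-- The map `u ↦ ∇u` as a continuous linear map. -/
def gradL (Ω : Set (E d)) : H10 Ω →L[ℝ] L2Mat Ω :=
  (WithLp.sndL 2 ℝ (L2Vec Ω) (L2Mat Ω)).comp (H10 Ω).subtypeL

/-- The map sending an element of `H¹₀` to its field as a continuous linear map. -/
def fieldL (Ω : Set (E d)) : H10 Ω →L[ℝ] L2Vec Ω :=
  (WithLp.fstL 2 ℝ (L2Vec Ω) (L2Mat Ω)).comp (H10 Ω).subtypeL

theorem grad_add (u v : H10 Ω) : grad (u + v) = grad u + grad v := (gradL Ω).map_add u v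
theorem grad_smul (c : ℝ) (u : H10 Ω) : grad (c • u) = c • grad u := (gradL Ω).map_smul c u
theorem field_add (u v : H10 Ω) : field (u + v) = field u + field v := (fieldL Ω).map_add u v
theorem field_sub (u v : H10 Ω) : field (u - v) = field u - field v := (fieldL Ω).map_sub u v
theorem field_smul (c : ℝ) (u : H10 Ω) : field (c • u) = c • field u := (fieldL Ω).map_smul c u
theorem field_zero : field (0 : H10 Ω) = 0 := (fieldL Ω).map_zero

theorem norm_sq_eq (u : H10 Ω) : ‖u‖ ^ 2 = ‖field u‖ ^ 2 + ‖grad u‖ ^ 2 :=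
  WithLp.prod_norm_sq_eq_of_L2 u.1

theorem norm_grad_le (u : H10 Ω) : ‖grad u‖ ≤ ‖u‖ := by
  have := norm_sq_eq u
  nlinarith [sq_nonneg ‖field u‖, norm_nonneg u, norm_nonneg (grad u)]

/-! ### Sobolev embedding of H¹₀ in L⁴ -/

/-- The operator norm is at most the Frobenius norm, by Cauchy–Schwarz in each row. This converts
the Sobolev inequality, phrased with `fderiv`, to `jacobian`. -/
theorem norm_fderiv_le_jacobian (φ : E d → E d) (x : E d) :
    ‖fderiv ℝ φ x‖ ≤ ‖jacobian φ x‖ := by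
  refine ContinuousLinearMap.opNorm_le_bound _ (norm_nonneg _) fun y => ?_
  have hy : fderiv ℝ φ x y = ∑ j, y j • fderiv ℝ φ x (EuclideanSpace.single j 1) := by
    conv_lhs => rw [← (EuclideanSpace.basisFun (Fin d) ℝ).sum_repr y]
    simp
  refine abs_le_of_sq_le_sq' ?_ (by positivity) |>.2
  rw [mul_pow, EuclideanSpace.norm_sq_eq, EuclideanSpace.norm_sq_eq, EuclideanSpace.norm_sq_eq,
    Fintype.sum_prod_type, Finset.sum_mul]
  refine Finset.sum_le_sum fun i _ => ?_
  simp only [Real.norm_eq_abs, sq_abs, jacobian_apply]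
  have : fderiv ℝ φ x y i = ∑ j, fderiv ℝ φ x (EuclideanSpace.single j 1) i * y j := by
    rw [hy]
    simp [mul_comm]
  rw [this]
  exact Finset.sum_mul_sq_le_sq_mul_sq _ _ _

theorem finrank_E : Module.finrank ℝ (E d) = d := by simp

/-- Sobolev embedding into `L⁴` for test fields, dimensions two and three. -/
theorem eLpNorm_four_test_le (hd : d = 2 ∨ d = 3) (hb : Bornology.IsBounded Ω) :
    ∃ K : ℝ≥0, ∀ φ : E d → E d, ContDiff ℝ ∞ φ → tsupport φ ⊆ Ω →
      eLpNorm φ 4 (volume.restrict Ω) ≤ K * eLpNorm (jacobian φ) 2 (volume.restrict Ω) := by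
  have hfin : volume Ω < ⊤ := hb.measure_lt_top
  -- The exponent whose Sobolev conjugate is 4 for d = 3, since 7/12 - 1/3 = 1/4. For d = 2 it is
  -- more than enough, and being below 2 it is controlled by the L² norm on the bounded set Ω.
  let p : ℝ≥0 := 12 / 7
  let c1 : ℝ≥0 := eLpNormLESNormFDerivOfLeConst (E d) (volume : Measure (E d)) Ω p 4
  let c2 : ℝ≥0∞ := (volume Ω) ^ (1 / (p : ℝ) - 1 / 2)
  have hc2 : c2 ≠ ⊤ := ENNReal.rpow_ne_top_of_nonneg (by norm_num [p]) hfin.ne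
  refine ⟨c1 * c2.toNNReal, fun φ hφ hs => ?_⟩
  have hφ1 : ContDiff ℝ 1 φ := hφ.of_le (by exact_mod_cast le_top)
  have h1 : eLpNorm φ (4 : ℝ≥0) volume ≤ c1 * eLpNorm (fderiv ℝ φ) p volume := by
    refine eLpNorm_le_eLpNorm_fderiv_of_le volume hφ1 (subset_closure.trans hs) ?_ ?_ ?_ hb
    · rw [← NNReal.coe_le_coe]; norm_num [p]
    · rw [finrank_E, ← NNReal.coe_lt_coe]
      rcases hd with rfl | rfl <;> norm_num [p]
    · rw [finrank_E]
      rcases hd with rfl | rfl <;> norm_num [p]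
  have hsup : (fderiv ℝ φ).support ⊆ Ω := (support_fderiv_subset ℝ).trans hs
  rw [← eLpNorm_restrict_eq_of_support_subset (f := fderiv ℝ φ) (p := p) (μ := volume) hsup] at h1
  have hcont : Continuous (fderiv ℝ φ) := hφ1.continuous_fderiv one_ne_zero
  have h2 : eLpNorm (fderiv ℝ φ) p (volume.restrict Ω) ≤
      eLpNorm (fderiv ℝ φ) 2 (volume.restrict Ω) * c2 := by
    have := eLpNorm_le_eLpNorm_mul_rpow_measure_univ (μ := volume.restrict Ω)
      (p := (p : ℝ≥0∞)) (q := 2) (f := fderiv ℝ φ) ?_ hcont.aestronglyMeasurable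
    · simpa [c2] using this
    · rw [show (2 : ℝ≥0∞) = ((2 : ℝ≥0) : ℝ≥0∞) from rfl, ENNReal.coe_le_coe,
        ← NNReal.coe_le_coe]
      norm_num [p]
  have h3 : eLpNorm (fderiv ℝ φ) 2 (volume.restrict Ω) ≤
      eLpNorm (jacobian φ) 2 (volume.restrict Ω) :=
    eLpNorm_mono (norm_fderiv_le_jacobian φ)
  calc eLpNorm φ 4 (volume.restrict Ω) ≤ eLpNorm φ 4 volume :=
        eLpNorm_mono_measure _ Measure.restrict_le_self
    _ ≤ c1 * eLpNorm (fderiv ℝ φ) p (volume.restrict Ω) := h1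
    _ ≤ c1 * (eLpNorm (jacobian φ) 2 (volume.restrict Ω) * c2) := by
      gcongr
      exact h2.trans (by gcongr)
    _ = _ := by
      rw [ENNReal.coe_mul, ENNReal.coe_toNNReal hc2]
      ring

/-- Sobolev embedding `H¹₀ ⊆ L⁴` in dimensions two and three. -/
theorem eLpNorm_four_field_le (hd : d = 2 ∨ d = 3) (hb : Bornology.IsBounded Ω) :
    ∃ K : ℝ≥0, ∀ u : H10 Ω,
      eLpNorm (field u) 4 (volume.restrict Ω) ≤ K * ENNReal.ofReal ‖grad u‖ := by
  obtain ⟨K, hK⟩ := eLpNorm_four_test_le hd hb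
  refine ⟨K, fun u => ?_⟩
  obtain ⟨s, hs, hlim⟩ := exists_seq_test u
  have hbound : ∀ n, eLpNorm (field (s n)) 4 (volume.restrict Ω) ≤
      K * ENNReal.ofReal ‖grad (s n)‖ := fun n => by
    obtain ⟨φ, h1, h2, h3, h4, h5⟩ := hs n
    have e1 : eLpNorm (field (s n)) 4 (volume.restrict Ω) = eLpNorm φ 4 (volume.restrict Ω) :=
      eLpNorm_congr_ae h4
    have e2 : ENNReal.ofReal ‖grad (s n)‖ = eLpNorm (jacobian φ) 2 (volume.restrict Ω) := by
      rw [Lp.norm_def, ENNReal.ofReal_toReal (Lp.eLpNorm_ne_top _)]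
      exact eLpNorm_congr_ae h5
    rw [e1, e2]
    exact hK φ h1 h3
  have hf : Filter.Tendsto (fun n => field (s n)) Filter.atTop (nhds (field u)) :=
    ((fieldL Ω).continuous.tendsto u).comp hlim
  have hg : Filter.Tendsto (fun n => grad (s n)) Filter.atTop (nhds (grad u)) :=
    ((gradL Ω).continuous.tendsto u).comp hlim
  -- L² convergence gives a.e. convergence along a subsequence, and the L⁴ norm is lower
  -- semicontinuous under a.e. limits; no convergence in L⁴ is needed.
  obtain ⟨ns, hns, hae⟩ := (tendstoInMeasure_of_tendsto_Lp hf).exists_seq_tendsto_ae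
  have hg' := (ENNReal.continuous_ofReal.tendsto _).comp ((hg.comp hns.tendsto_atTop).norm)
  have hlimK := ENNReal.Tendsto.const_mul (a := (K : ℝ≥0∞)) hg' (Or.inr ENNReal.coe_ne_top)
  calc eLpNorm (field u) 4 (volume.restrict Ω)
      ≤ Filter.liminf (fun n => eLpNorm (field (s (ns n))) 4 (volume.restrict Ω)) Filter.atTop :=
        Lp.eLpNorm_lim_le_liminf_eLpNorm (fun n => Lp.aestronglyMeasurable _) _ hae
    _ ≤ Filter.liminf (fun n => (K : ℝ≥0∞) * ENNReal.ofReal ‖grad (s (ns n))‖) Filter.atTop :=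
        Filter.liminf_le_liminf (Filter.Eventually.of_forall fun n => hbound _)
    _ = K * ENNReal.ofReal ‖grad u‖ := hlimK.liminf_eq

/-! ### Bilinearity and boundedness of the convection form -/

instance holderTriple_four_four_two : ENNReal.HolderTriple 4 4 2 where
  inv_add_inv_eq_inv := by
    rw [← ENNReal.toReal_eq_toReal_iff' (by simp) (by simp), ENNReal.toReal_add (by simp) (by simp)]
    norm_num

theorem memLp_field_four (hd : d = 2 ∨ d = 3) (hb : Bornology.IsBounded Ω) (u : H10 Ω) :
    MemLp (field u) 4 (volume.restrict Ω) := by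
  obtain ⟨K, hK⟩ := eLpNorm_four_field_le hd hb
  exact ⟨Lp.aestronglyMeasurable _,
    (hK u).trans_lt (ENNReal.mul_lt_top ENNReal.coe_lt_top ENNReal.ofReal_lt_top)⟩

/-- The product of two L⁴ factors is in L², and the gradient entry is in L². Without integrability
the Bochner integral would not be additive, nor b linear. -/
theorem integrable_convection_term (hd : d = 2 ∨ d = 3) (hb : Bornology.IsBounded Ω)
    (u v w : H10 Ω) (i j : Fin d) :
    Integrable (fun x => field u x j * grad v x (i, j) * field w x i) (volume.restrict Ω) := by
  have hu := (memLp_field_four hd hb u).eval_piLp j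
  have hw := (memLp_field_four hd hb w).eval_piLp i
  have hv := (Lp.memLp (grad v)).eval_piLp (i, j)
  have h1 : MemLp (fun x => field u x j * field w x i) 2 (volume.restrict Ω) := hw.mul' hu
  have h2 := memLp_one_iff_integrable.1 (hv.mul' h1 (r := 1))
  exact h2.congr (Filter.Eventually.of_forall fun x => by ring)

theorem b_eq_sum (hd : d = 2 ∨ d = 3) (hb : Bornology.IsBounded Ω) (u v w : H10 Ω) :
    b u v w = ∑ i, ∑ j, ∫ x in Ω, field u x j * grad v x (i, j) * field w x i := by
  have h := integrable_convection_term hd hb u v w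
  simp only [b, Finset.sum_mul]
  rw [integral_finsetSum _ fun i _ => integrable_finsetSum _ fun j _ => h i j]
  exact Finset.sum_congr rfl fun i _ => integral_finsetSum _ fun j _ => h i j

theorem b_add_mid (hd : d = 2 ∨ d = 3) (hb : Bornology.IsBounded Ω) (u v v' w : H10 Ω) :
    b u (v + v') w = b u v w + b u v' w := by
  simp only [b_eq_sum hd hb, ← Finset.sum_add_distrib]
  refine Finset.sum_congr rfl fun i _ => Finset.sum_congr rfl fun j _ => ?_
  rw [← integral_add (integrable_convection_term hd hb u v w i j)
    (integrable_convection_term hd hb u v' w i j)]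
  refine integral_congr_ae ?_
  rw [grad_add]
  filter_upwards [Lp.coeFn_add (grad v) (grad v')] with x hx
  simp only [hx, Pi.add_apply, PiLp.add_apply]
  ring

theorem b_add_right (hd : d = 2 ∨ d = 3) (hb : Bornology.IsBounded Ω) (u v w w' : H10 Ω) :
    b u v (w + w') = b u v w + b u v w' := by
  simp only [b_eq_sum hd hb, ← Finset.sum_add_distrib]
  refine Finset.sum_congr rfl fun i _ => Finset.sum_congr rfl fun j _ => ?_
  rw [← integral_add (integrable_convection_term hd hb u v w i j)
    (integrable_convection_term hd hb u v w' i j)]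
  refine integral_congr_ae ?_
  rw [field_add]
  filter_upwards [Lp.coeFn_add (field w) (field w')] with x hx
  simp only [hx, Pi.add_apply, PiLp.add_apply]
  ring

theorem b_smul_mid (c : ℝ) (u v w : H10 Ω) : b u (c • v) w = c * b u v w := by
  rw [b, b, ← integral_const_mul]
  refine integral_congr_ae ?_
  rw [grad_smul]
  filter_upwards [Lp.coeFn_smul c (grad v)] with x hx
  simp only [hx, Pi.smul_apply, PiLp.smul_apply, smul_eq_mul, Finset.mul_sum, Finset.sum_mul]
  refine Finset.sum_congr rfl fun i _ => Finset.sum_congr rfl fun j _ => by ring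

theorem b_smul_right (c : ℝ) (u v w : H10 Ω) : b u v (c • w) = c * b u v w := by
  rw [b, b, ← integral_const_mul]
  refine integral_congr_ae ?_
  rw [field_smul]
  filter_upwards [Lp.coeFn_smul c (field w)] with x hx
  simp only [hx, Pi.smul_apply, PiLp.smul_apply, smul_eq_mul, Finset.mul_sum, Finset.sum_mul]
  refine Finset.sum_congr rfl fun i _ => Finset.sum_congr rfl fun j _ => by ring

/-- Cauchy–Schwarz over index pairs: the array a_j c_i has Euclidean norm ‖a‖ ‖c‖, so no dimensional
constant appears. -/
theorem abs_convection_le (a c : E d) (G : Mat d) :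
    |∑ i, (∑ j, a j * G (i, j)) * c i| ≤ ‖a‖ * ‖c‖ * ‖G‖ := by
  refine abs_le_of_sq_le_sq ?_ (by positivity)
  have h := Finset.sum_mul_sq_le_sq_mul_sq (Finset.univ : Finset (Fin d × Fin d))
    (fun ij => a ij.2 * c ij.1) (fun ij => G ij)
  have e1 : ∑ i, (∑ j, a j * G (i, j)) * c i = ∑ ij : Fin d × Fin d, a ij.2 * c ij.1 * G ij := by
    rw [Fintype.sum_prod_type]
    simp only [Finset.sum_mul]
    exact Finset.sum_congr rfl fun i _ => Finset.sum_congr rfl fun j _ => by ring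
  have e2 : ∑ ij : Fin d × Fin d, (a ij.2 * c ij.1) ^ 2 = ‖a‖ ^ 2 * ‖c‖ ^ 2 := by
    simp only [EuclideanSpace.norm_sq_eq, Fintype.sum_prod_type, mul_pow, Finset.sum_mul_sum,
      Real.norm_eq_abs, sq_abs]
    exact Finset.sum_comm
  rw [e1, mul_pow, mul_pow, ← e2, EuclideanSpace.norm_sq_eq G]
  simpa only [Real.norm_eq_abs, sq_abs] using h

theorem enorm_integral_le_four_four_two {α F G H : Type*} [MeasurableSpace α] {μ : Measure α}
    [NormedAddCommGroup F] [NormedAddCommGroup G] [NormedAddCommGroup H] {f : α → ℝ}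
    {p : α → F} {q : α → G} {r : α → H} (hp : AEStronglyMeasurable p μ)
    (hq : AEStronglyMeasurable q μ) (hr : AEStronglyMeasurable r μ)
    (h : ∀ x, |f x| ≤ ‖p x‖ * ‖q x‖ * ‖r x‖) :
    ‖∫ x, f x ∂μ‖ₑ ≤ eLpNorm p 4 μ * eLpNorm q 4 μ * eLpNorm r 2 μ := by
  have h2 : eLpNorm (fun x => ‖p x‖ * ‖q x‖ * ‖r x‖) 1 μ ≤
      eLpNorm (fun x => ‖p x‖ * ‖q x‖) 2 μ * eLpNorm (fun x => ‖r x‖) 2 μ :=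
    eLpNorm_smul_le_mul_eLpNorm (p := 2) (q := 2) (r := 1) (f := fun x => ‖r x‖)
      (φ := fun x => ‖p x‖ * ‖q x‖) hr.norm (hp.norm.mul hq.norm)
  have h3 : eLpNorm (fun x => ‖p x‖ * ‖q x‖) 2 μ ≤
      eLpNorm (fun x => ‖p x‖) 4 μ * eLpNorm (fun x => ‖q x‖) 4 μ :=
    eLpNorm_smul_le_mul_eLpNorm (p := 4) (q := 4) (r := 2) (f := fun x => ‖q x‖)
      (φ := fun x => ‖p x‖) hq.norm hp.norm
  rw [eLpNorm_norm, eLpNorm_norm] at h3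
  rw [eLpNorm_norm] at h2
  refine (enorm_integral_le_lintegral_enorm _).trans ?_
  rw [← eLpNorm_one_eq_lintegral_enorm]
  exact (eLpNorm_mono_real h).trans (h2.trans (mul_le_mul_left h3 _))

theorem exists_isConvectionConstant (hd : d = 2 ∨ d = 3) (hb : Bornology.IsBounded Ω) :
    ∃ C : ℝ, IsConvectionConstant Ω C := by
  obtain ⟨K, hK⟩ := eLpNorm_four_field_le hd hb
  refine ⟨K * K + 1, by positivity, fun u v w => ?_⟩
  have h1 : ‖b u v w‖ₑ ≤ eLpNorm (field u) 4 (volume.restrict Ω) *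
      eLpNorm (field w) 4 (volume.restrict Ω) * eLpNorm (grad v) 2 (volume.restrict Ω) :=
    enorm_integral_le_four_four_two (Lp.aestronglyMeasurable _) (Lp.aestronglyMeasurable _)
      (Lp.aestronglyMeasurable _) fun x => abs_convection_le _ _ _
  have h4 : eLpNorm (grad v) 2 (volume.restrict Ω) = ENNReal.ofReal ‖grad v‖ := by
    rw [Lp.norm_def, ENNReal.ofReal_toReal (Lp.eLpNorm_ne_top _)]
  have h5 : ‖b u v w‖ₑ ≤ ENNReal.ofReal (K * ‖grad u‖ * (K * ‖grad w‖) * ‖grad v‖) := by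
    rw [ENNReal.ofReal_mul (by positivity), ENNReal.ofReal_mul (by positivity),
      ENNReal.ofReal_mul (by positivity), ENNReal.ofReal_mul (by positivity),
      ENNReal.ofReal_coe_nnreal, ← h4]
    exact h1.trans (mul_le_mul_left (mul_le_mul' (hK u) (hK w)) _)
  rw [Real.enorm_eq_ofReal_abs, ENNReal.ofReal_le_ofReal_iff (by positivity)] at h5
  refine h5.trans ?_
  have : 0 ≤ ‖grad u‖ * ‖grad v‖ * ‖grad w‖ := by positivity
  linarith

/-- For fixed `u`, the convection form as a bounded bilinear form. -/
def bL (hd : d = 2 ∨ d = 3) (hb : Bornology.IsBounded Ω) (u : H10 Ω) :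
    H10 Ω →L[ℝ] H10 Ω →L[ℝ] ℝ :=
  LinearMap.mkContinuous₂
    (LinearMap.mk₂ ℝ (b u) (b_add_mid hd hb u) (fun c v w => b_smul_mid c u v w)
      (b_add_right hd hb u) (fun c v w => b_smul_right c u v w))
    ((exists_isConvectionConstant hd hb).choose * ‖grad u‖) fun v w => by
      have hC := (exists_isConvectionConstant hd hb).choose_spec
      set C := (exists_isConvectionConstant hd hb).choose
      refine (hC.2 u v w).trans ?_
      have := hC.1.le
      gcongr <;> exact norm_grad_le _

/-! ### Poincaré inequality and the dual norm -/

/-- On a set of finite measure the L² norm is controlled by the L⁴ norm, hence by the gradient. -/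
theorem exists_poincare (hd : d = 2 ∨ d = 3) (hb : Bornology.IsBounded Ω) :
    ∃ K : ℝ, 0 ≤ K ∧ ∀ u : H10 Ω, ‖field u‖ ≤ K * ‖grad u‖ := by
  obtain ⟨K, hK⟩ := eLpNorm_four_field_le hd hb
  let c : ℝ≥0∞ := volume.restrict Ω Set.univ ^ (1 / (2 : ℝ≥0∞).toReal - 1 / (4 : ℝ≥0∞).toReal)
  have hc : c ≠ ⊤ := ENNReal.rpow_ne_top_of_nonneg (by norm_num)
    (by simpa using hb.measure_lt_top.ne)
  refine ⟨K * c.toReal, by positivity, fun u => ?_⟩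
  have h : eLpNorm (field u) 2 (volume.restrict Ω) ≤ eLpNorm (field u) 4 (volume.restrict Ω) * c :=
    eLpNorm_le_eLpNorm_mul_rpow_measure_univ (by norm_num) (Lp.aestronglyMeasurable _)
  have h' := h.trans (mul_le_mul_left (hK u) c)
  rw [Lp.norm_def]
  refine (ENNReal.toReal_mono (by finiteness) h').trans (le_of_eq ?_)
  simp
  ring

/-- A real supremum bounds its terms only if the family is bounded above. The Poincaré inequality
ensures this, and it also forces f φ = 0 when ∇φ = 0, where the quotient carries no information. -/
theorem abs_apply_le_negNorm (hd : d = 2 ∨ d = 3) (hb : Bornology.IsBounded Ω) (f : HNeg Ω)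
    (φ : H10 Ω) : |f φ| ≤ negNorm f * ‖grad φ‖ := by
  obtain ⟨K, hK0, hK⟩ := exists_poincare hd hb
  have hφ : ∀ φ : H10 Ω, |f φ| ≤ ‖f‖ * (K + 1) * ‖grad φ‖ := fun φ => by
    have h1 : ‖φ‖ ≤ (K + 1) * ‖grad φ‖ := by
      refine abs_le_of_sq_le_sq' ?_ (by positivity) |>.2
      rw [norm_sq_eq]
      have h2 : ‖field φ‖ ^ 2 ≤ (K * ‖grad φ‖) ^ 2 := by gcongr; exact hK φ
      nlinarith [mul_nonneg hK0 (sq_nonneg ‖grad φ‖)]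
    calc |f φ| ≤ ‖f‖ * ‖φ‖ := f.le_opNorm φ
      _ ≤ ‖f‖ * ((K + 1) * ‖grad φ‖) := by gcongr
      _ = _ := by ring
  rcases (norm_nonneg (grad φ)).eq_or_lt with h0 | hpos
  · have := hφ φ
    rw [← h0, mul_zero] at this ⊢
    exact this
  · rw [← div_le_iff₀ hpos]
    refine le_ciSup (f := fun φ : H10 Ω => |f φ| / ‖grad φ‖) ⟨‖f‖ * (K + 1), ?_⟩ φ
    rintro _ ⟨ψ, rfl⟩
    exact div_le_of_le_mul₀ (norm_nonneg _) (by positivity) (hφ ψ)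

/-! ### Integration by parts -/

theorem memLp_of_continuous (hb : Bornology.IsBounded Ω) {F : Type*} [NormedAddCommGroup F]
    {g : E d → F} (hg : Continuous g) : MemLp g 2 (volume.restrict Ω) := by
  obtain ⟨C, hC⟩ := hb.isCompact_closure.exists_bound_of_continuousOn hg.continuousOn
  have : IsFiniteMeasure (volume.restrict Ω) :=
    ⟨by simpa using hb.measure_lt_top⟩
  have h : ∀ᵐ x ∂(volume.restrict (closure Ω)), ‖g x‖ ≤ C :=
    (ae_restrict_mem isClosed_closure.measurableSet).mono fun x hx => hC x hx
  exact MemLp.of_bound hg.aestronglyMeasurable C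
    (ae_mono (Measure.restrict_mono subset_closure le_rfl) h)

theorem fderiv_coord {φ : E d → E d} {x : E d} (hφ : DifferentiableAt ℝ φ x) (i : Fin d)
    (v : E d) : fderiv ℝ (fun y => φ y i) x v = fderiv ℝ φ x v i := by
  have h := ((EuclideanSpace.proj i : E d →L[ℝ] ℝ).hasFDerivAt.comp x
    hφ.hasFDerivAt).fderiv
  have h' := congrArg (fun L => L v) h
  exact h'

/-- Compact support of φ alone removes the boundary term, so ψ may be any C¹ function, in particular
a polynomial. -/
theorem integral_test_mul_fderiv {φ : E d → ℝ} {ψ : E d → ℝ} (hφ : ContDiff ℝ 1 φ)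
    (hc : HasCompactSupport φ) (hs : tsupport φ ⊆ Ω) (hψ : ContDiff ℝ 1 ψ) (e : E d) :
    ∫ x in Ω, φ x * fderiv ℝ ψ x e = -∫ x in Ω, fderiv ℝ φ x e * ψ x := by
  have hφ' := hφ.continuous_fderiv one_ne_zero
  have hψ' := hψ.continuous_fderiv one_ne_zero
  have h0 : ∀ x, x ∉ Ω → φ x = 0 := fun x hx => image_eq_zero_of_notMem_tsupport fun h => hx (hs h)
  have h1 : ∀ x, x ∉ Ω → fderiv ℝ φ x = 0 := fun x hx => by
    by_contra h
    exact hx (hs (support_fderiv_subset ℝ h))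
  rw [setIntegral_eq_integral_of_forall_compl_eq_zero fun x hx => by simp [h0 x hx],
    setIntegral_eq_integral_of_forall_compl_eq_zero fun x hx => by simp [h1 x hx]]
  have hc' : HasCompactSupport fun x => fderiv ℝ φ x e :=
    hc.fderiv_apply ℝ e
  have c1 : Continuous fun x => fderiv ℝ φ x e := by fun_prop
  have c2 : Continuous fun x => fderiv ℝ ψ x e := by fun_prop
  refine integral_mul_fderiv_eq_neg_fderiv_mul_of_integrable ?_ ?_ ?_
    (fun x _ => hφ.differentiable one_ne_zero x) (fun x _ => hψ.differentiable one_ne_zero x)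
  · exact (c1.mul hψ.continuous).integrable_of_hasCompactSupport hc'.mul_right
  · exact (hφ.continuous.mul c2).integrable_of_hasCompactSupport hc.mul_right
  · exact (hφ.continuous.mul hψ.continuous).integrable_of_hasCompactSupport hc.mul_right

/-- Integration by parts for elements of `H¹₀`. -/
theorem integral_field_mul_fderiv (hb : Bornology.IsBounded Ω) (u : H10 Ω) {ψ : E d → ℝ}
    (hψ : ContDiff ℝ 1 ψ) (i j : Fin d) :
    ∫ x in Ω, field u x i * fderiv ℝ ψ x (EuclideanSpace.single j 1) =
      -∫ x in Ω, grad u x (i, j) * ψ x := by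
  have hψ' := hψ.continuous_fderiv one_ne_zero
  have hF : MemLp (fun x => (EuclideanSpace.single i
      (fderiv ℝ ψ x (EuclideanSpace.single j 1)) : E d)) 2 (volume.restrict Ω) := by
    refine memLp_of_continuous hb ((PiLp.continuous_toLp 2 _).comp
      ((continuous_single i).comp ?_))
    fun_prop
  have hG : MemLp (fun x => (EuclideanSpace.single (i, j) (ψ x) : Mat d)) 2
      (volume.restrict Ω) := by
    exact memLp_of_continuous hb ((PiLp.continuous_toLp 2 _).comp
      ((continuous_single (i, j)).comp hψ.continuous))
  -- The identity to be proved says that this continuous functional vanishes at (u, ∇u). Its kernel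
  -- is closed, so test pairs suffice.
  let L : WithLp 2 (L2Vec Ω × L2Mat Ω) →L[ℝ] ℝ := innerSL ℝ (WithLp.toLp 2 (hF.toLp, hG.toLp))
  have hL : ∀ p, L p = (∫ x in Ω, p.fst x i * fderiv ℝ ψ x (EuclideanSpace.single j 1)) +
      ∫ x in Ω, p.snd x (i, j) * ψ x := fun p => by
    have e : L p = inner ℝ hF.toLp p.fst + inner ℝ hG.toLp p.snd := rfl
    rw [e, L2.inner_def, L2.inner_def]
    congr 1
    · refine integral_congr_ae ?_
      filter_upwards [hF.coeFn_toLp] with x hx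
      rw [hx]
      exact (EuclideanSpace.inner_single_left _ _ _).trans (mul_comm _ _)
    · refine integral_congr_ae ?_
      filter_upwards [hG.coeFn_toLp] with x hx
      rw [hx]
      exact (EuclideanSpace.inner_single_left _ _ _).trans (mul_comm _ _)
  have hle : H10 Ω ≤ LinearMap.ker (L : WithLp 2 (L2Vec Ω × L2Mat Ω) →ₗ[ℝ] ℝ) := by
    refine Submodule.topologicalClosure_minimal _ (Submodule.span_le.2 ?_) L.isClosed_ker
    rintro p ⟨φ, h1, h2, h3, h4, h5⟩
    have h1' : ContDiff ℝ 1 φ := h1.of_le (by exact_mod_cast le_top)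
    change L p = 0
    have e1 : ∫ x in Ω, p.fst x i * fderiv ℝ ψ x (EuclideanSpace.single j 1) =
        ∫ x in Ω, φ x i * fderiv ℝ ψ x (EuclideanSpace.single j 1) :=
      integral_congr_ae (h4.mono fun x hx => by simp only [hx])
    have e2 : ∫ x in Ω, p.snd x (i, j) * ψ x =
        ∫ x in Ω, fderiv ℝ (fun y => φ y i) x (EuclideanSpace.single j 1) * ψ x :=
      integral_congr_ae (h5.mono fun x hx => by
        simp only [hx, jacobian_apply, fderiv_coord (h1'.differentiable one_ne_zero x)])
    have hsub : tsupport (fun y => φ y i) ⊆ tsupport φ :=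
      closure_mono fun x hx h => hx (by simp [h])
    rw [hL, e1, e2, integral_test_mul_fderiv (φ := fun y => φ y i) (by fun_prop)
      (h2.mono fun x hx h => hx (by simp [h])) (hsub.trans h3) hψ, neg_add_cancel]
  have := hle u.2
  have h0 : L u.1 = 0 := this
  rw [hL] at h0
  exact eq_neg_of_add_eq_zero_left h0

/-- Integration by parts against the constant 1. It gives divergences the zero mean required in Q_h.
-/
theorem integral_grad_eq_zero (hb : Bornology.IsBounded Ω) (u : H10 Ω) (i j : Fin d) :
    ∫ x in Ω, grad u x (i, j) = 0 := by
  have := integral_field_mul_fderiv hb u (contDiff_const (c := (1 : ℝ))) i j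
  simpa using this

/-! ### Discretely divergence free fields are divergence free -/

theorem contDiff_mvPolynomial_eval (p : MvPolynomial (Fin d) ℝ) {n : WithTop ℕ∞} :
    ContDiff ℝ n fun x : E d => MvPolynomial.eval (fun i => x i) p := by
  induction p using MvPolynomial.induction_on with
  | C a => simpa using contDiff_const
  | add p q hp hq => simpa using hp.add hq
  | mul_X p i hp =>
    simp only [map_mul, MvPolynomial.eval_X]
    exact hp.mul (by fun_prop)

theorem fderiv_mvPolynomial_eval (p : MvPolynomial (Fin d) ℝ) (x : E d) (j : Fin d) :
    fderiv ℝ (fun x : E d => MvPolynomial.eval (fun i => x i) p) x (EuclideanSpace.single j 1) =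
      MvPolynomial.eval (fun i => x i) (MvPolynomial.pderiv j p) := by
  have hdiff : ∀ p : MvPolynomial (Fin d) ℝ,
      DifferentiableAt ℝ (fun x : E d => MvPolynomial.eval (fun i => x i) p) x :=
    fun p => (contDiff_mvPolynomial_eval p (n := 1)).differentiable one_ne_zero x
  induction p using MvPolynomial.induction_on with
  | C a => simp
  | add p q hp hq =>
    simp only [map_add]
    rw [fderiv_fun_add (hdiff p) (hdiff q), ← hp, ← hq]
    rfl
  | mul_X p i hp =>
    have hX : HasFDerivAt (fun y : E d => y i)
        (EuclideanSpace.proj i : E d →L[ℝ] ℝ) x :=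
      (EuclideanSpace.proj i : E d →L[ℝ] ℝ).hasFDerivAt
    simp only [map_mul, MvPolynomial.eval_X]
    rw [fderiv_fun_mul (hdiff p) hX.differentiableAt, hX.fderiv]
    simp only [add_apply, smul_apply, hp,
      Derivation.leibniz, MvPolynomial.pderiv_X, smul_eq_mul, map_add, map_mul,
      MvPolynomial.eval_X]
    rcases eq_or_ne i j with rfl | h
    · simp
    · simp [h]

/-- The drop by one degree is what matches X_h with Q_h. Truncated subtraction is harmless: in
degree 0 the derivative vanishes. -/
theorem totalDegree_pderiv_le (p : MvPolynomial (Fin d) ℝ) (j : Fin d) :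
    (MvPolynomial.pderiv j p).totalDegree ≤ p.totalDegree - 1 := by
  conv_lhs => rw [p.as_sum, map_sum]
  refine MvPolynomial.totalDegree_finsetSum_le fun s hs => ?_
  rw [MvPolynomial.pderiv_monomial]
  rcases Nat.eq_zero_or_pos (s j) with h0 | hpos
  · simp [h0]
  · have h1 := MvPolynomial.le_totalDegree hs
    have h2 := MvPolynomial.totalDegree_monomial_le (s - Finsupp.single j 1)
      (MvPolynomial.coeff s p * (s j : ℝ))
    have h3 : (s - Finsupp.single j 1).degree + 1 = s.degree := by
      have h4 : s - Finsupp.single j 1 + Finsupp.single j 1 = s :=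
        tsub_add_cancel_of_le (Finsupp.single_le_iff.2 hpos)
      conv_rhs => rw [← h4]
      simp
    have h5 : (s - Finsupp.single j 1).sum (fun _ => id) = (s - Finsupp.single j 1).degree := rfl
    have h6 : (s.sum fun _ e => e) = s.degree := rfl
    omega

/-- On each cell the weak gradient of a piecewise polynomial is the classical one. -/
theorem grad_ae_eq_pderiv (hΩ : IsOpen Ω) (hb : Bornology.IsBounded Ω) (u : H10 Ω)
    {K : Set (E d)} (hK : Convex ℝ K) {p : MvPolynomial (Fin d) ℝ} {i : Fin d}
    (hp : ∀ᵐ x ∂(volume.restrict Ω), x ∈ K → field u x i = MvPolynomial.eval (fun i => x i) p)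
    (j : Fin d) : ∀ᵐ x ∂(volume.restrict Ω), x ∈ K →
      grad u x (i, j) = MvPolynomial.eval (fun i => x i) (MvPolynomial.pderiv j p) := by
  set P : E d → ℝ := fun x => MvPolynomial.eval (fun i => x i) p with hPdef
  have hP : ContDiff ℝ 1 P := contDiff_mvPolynomial_eval p
  set P' : E d → ℝ := fun x => MvPolynomial.eval (fun i => x i) (MvPolynomial.pderiv j p)
    with hP'def
  have hP' : Continuous P' := (contDiff_mvPolynomial_eval _ (n := 1)).continuous
  have : IsFiniteMeasure (volume.restrict Ω) := ⟨by simpa using hb.measure_lt_top⟩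
  have hgrad : MemLp (fun x => grad u x (i, j)) 2 (volume.restrict Ω) :=
    (Lp.memLp (grad u)).eval_piLp (i, j)
  have hf : MemLp (fun x => grad u x (i, j) - P' x) 2 (volume.restrict Ω) :=
    hgrad.sub (memLp_of_continuous hb hP')
  -- Against a test function supported inside the cell, integrating u by parts and integrating its
  -- polynomial by parts give the same value; the fundamental lemma of the calculus of variations
  -- then applies.
  have key : ∀ᵐ x ∂(volume.restrict Ω), x ∈ interior K ∩ Ω → grad u x (i, j) - P' x = 0 := by
    refine (isOpen_interior.inter hΩ).ae_eq_zero_of_integral_contDiff_smul_eq_zero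
      ((hf.integrable one_le_two).locallyIntegrable.locallyIntegrableOn _) fun ψ h1 h2 h3 => ?_
    have h1' : ContDiff ℝ 1 ψ := h1.of_le (by exact_mod_cast le_top)
    have hψ := memLp_of_continuous hb h1'.continuous
    have e1 := integral_field_mul_fderiv hb u h1' i j
    have e2 := integral_test_mul_fderiv h1' h2 (h3.trans Set.inter_subset_right) hP
      (EuclideanSpace.single j 1)
    have e3 : ∫ x in Ω, field u x i * fderiv ℝ ψ x (EuclideanSpace.single j 1) =
        ∫ x in Ω, fderiv ℝ ψ x (EuclideanSpace.single j 1) * P x := by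
      refine integral_congr_ae (hp.mono fun x hx => ?_)
      by_cases hxK : x ∈ K
      · simp only [hx hxK, hPdef]
        ring
      · have : fderiv ℝ ψ x = 0 := by
          by_contra h
          exact hxK (interior_subset (h3 (support_fderiv_subset ℝ h)).1)
        simp [this]
    have e4 : ∫ x in Ω, ψ x * fderiv ℝ P x (EuclideanSpace.single j 1) =
        ∫ x in Ω, ψ x * P' x :=
      integral_congr_ae (Filter.Eventually.of_forall fun x => by
        simp only [hPdef, hP'def, fderiv_mvPolynomial_eval])
    have i1 : Integrable (fun x => ψ x * grad u x (i, j)) (volume.restrict Ω) :=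
      hψ.integrable_mul hgrad
    have i2 : Integrable (fun x => ψ x * P' x) (volume.restrict Ω) :=
      hψ.integrable_mul (memLp_of_continuous hb hP')
    have e5 : ∫ x in Ω, grad u x (i, j) * ψ x = ∫ x in Ω, ψ x * grad u x (i, j) := by
      simp only [mul_comm]
    simp only [smul_eq_mul, mul_sub]
    rw [integral_sub i1 i2]
    linarith
  -- The frontier of a convex set is null, so the interior of the cell accounts for almost all of
  -- it.
  have hfr : ∀ᵐ x ∂(volume.restrict Ω), x ∉ frontier K :=
    ae_restrict_of_ae (measure_eq_zero_iff_ae_notMem.1 (hK.addHaar_frontier volume))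
  filter_upwards [key, hfr, ae_restrict_mem hΩ.measurableSet] with x hx hxf hxΩ hxK
  have hint : x ∈ interior K := by
    by_contra h
    exact hxf ⟨subset_closure hxK, h⟩
  exact sub_eq_zero.1 (hx ⟨hint, hxΩ⟩)

theorem memLp_divergence (u : H10 Ω) : MemLp (divergence u) 2 (volume.restrict Ω) :=
  memLp_finsetSum _ fun i _ => (Lp.memLp (grad u)).eval_piLp (i, i)

/-- Discretely divergence free fields are exactly divergence free. -/
theorem divergence_ae_eq_zero (hΩ : IsOpen Ω) (hb : Bornology.IsBounded Ω)
    (𝒯 : Triangulation Ω) {k : ℕ} {u : H10 Ω} (hu : u ∈ discreteDivFree 𝒯 k) :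
    divergence u =ᵐ[volume.restrict Ω] 0 := by
  have : IsFiniteMeasure (volume.restrict Ω) := ⟨by simpa using hb.measure_lt_top⟩
  have hm := memLp_divergence u
  -- The divergence itself is the pressure test function: testing with it gives ∫ (div u)² = 0.
  have hq : hm.toLp ∈ pressureSpace 𝒯 k := by
    refine ⟨?_, fun s hs => ?_⟩
    · rw [integral_congr_ae hm.coeFn_toLp]
      simp only [divergence]
      rw [integral_finsetSum _ fun i _ =>
        ((Lp.memLp (grad u)).eval_piLp (i, i)).integrable one_le_two]
      exact Finset.sum_eq_zero fun i _ => integral_grad_eq_zero hb u i i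
    · choose p hp hpe using fun i => hu.1 i s hs
      refine ⟨∑ i, MvPolynomial.pderiv i (p i), MvPolynomial.totalDegree_finsetSum_le fun i _ =>
        (totalDegree_pderiv_le (p i) i).trans (Nat.sub_le_sub_right (hp i) 1), ?_⟩
      have h := fun i => grad_ae_eq_pderiv hΩ hb u (convex_convexHull ℝ (s : Set (E d))) (hpe i) i
      filter_upwards [hm.coeFn_toLp, eventually_countable_forall.2 h] with x hx hx' hxs
      rw [hx, divergence, map_sum]
      exact Finset.sum_congr rfl fun i _ => hx' i hxs
  have h0 := hu.2 _ hq
  have h1 : ∫ x in Ω, divergence u x ^ 2 = 0 := by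
    rw [← h0]
    refine integral_congr_ae ?_
    filter_upwards [hm.coeFn_toLp] with x hx
    rw [hx, sq]
  rw [integral_eq_zero_iff_of_nonneg (fun x => sq_nonneg _) hm.integrable_sq] at h1
  filter_upwards [h1] with x hx
  simpa using hx

/-! ### Skew-symmetry of the convection form -/

/-- The convection form is skew-symmetric for a divergence free advecting field. -/
theorem b_self_eq_zero (hd : d = 2 ∨ d = 3) (hb : Bornology.IsBounded Ω) {u : H10 Ω}
    (hu : divergence u =ᵐ[volume.restrict Ω] 0) (v : H10 Ω) : b u v v = 0 := by
  have htest : ∀ v : H10 Ω, (v : WithLp 2 (L2Vec Ω × L2Mat Ω)) ∈ testGraph Ω → b u v v = 0 := by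
    rintro v ⟨φ, h1, h2, h3, h4, h5⟩
    have h1' : ContDiff ℝ 1 φ := h1.of_le (by exact_mod_cast le_top)
    have h4' : field v =ᵐ[volume.restrict Ω] φ := h4
    have h5' : grad v =ᵐ[volume.restrict Ω] jacobian φ := h5
    -- Here φ_i ∂_jφ_i = ∂_j(φ_i²/2), and the derivative is moved onto u_j; summing over j produces
    -- div u.
    have hterm : ∀ i j, ∫ x in Ω, field u x j * grad v x (i, j) * field v x i =
        -∫ x in Ω, grad u x (j, j) * (φ x i ^ 2 / 2) := fun i j => by
      have hc : ContDiff ℝ 1 fun x => φ x i ^ 2 / 2 := by fun_prop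
      rw [← integral_field_mul_fderiv hb u hc j j]
      refine integral_congr_ae ?_
      filter_upwards [h4', h5'] with x hx hx'
      have hdi : DifferentiableAt ℝ (fun y => φ y i) x := by
        have := h1'.differentiable one_ne_zero
        fun_prop
      have hder : fderiv ℝ (fun y => φ y i ^ 2 / 2) x (EuclideanSpace.single j 1) =
          φ x i * fderiv ℝ (fun y => φ y i) x (EuclideanSpace.single j 1) := by
        have := (hdi.hasFDerivAt.pow 2).mul_const (1 / 2 : ℝ)
        simp only [div_eq_mul_one_div (_ ^ 2) (2 : ℝ)]
        rw [this.fderiv]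
        simp
        ring
      rw [hder, fderiv_coord (h1'.differentiable one_ne_zero x), hx, hx', jacobian_apply]
      ring
    rw [b_eq_sum hd hb]
    refine Finset.sum_eq_zero fun i _ => ?_
    have hint : ∀ j ∈ Finset.univ, Integrable (fun x => grad u x (j, j) * (φ x i ^ 2 / 2))
        (volume.restrict Ω) := fun j _ =>
      ((Lp.memLp (grad u)).eval_piLp (j, j)).integrable_mul
        (memLp_of_continuous hb (by have := h1'.continuous; fun_prop))
    simp only [hterm, Finset.sum_neg_distrib]
    rw [← integral_finsetSum _ hint, neg_eq_zero]
    refine integral_eq_zero_of_ae ?_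
    filter_upwards [hu] with x hx
    rw [← Finset.sum_mul]
    simp only [divergence, Pi.zero_apply] at hx
    simp [hx]
  obtain ⟨s, hs, hlim⟩ := exists_seq_test v
  -- Boundedness of b makes v ↦ b(u, v, v) continuous, so its vanishing passes from test fields to
  -- their limits.
  have hcont : Continuous fun v => bL hd hb u v v := by fun_prop
  have h := (hcont.tendsto v).comp hlim
  have h0 : (fun v => bL hd hb u v v) ∘ s = fun _ => 0 := funext fun n => htest _ (hs n)
  rw [h0] at h
  exact (tendsto_nhds_unique h tendsto_const_nhds)

/-! ### Subspaces containing iterates, extrapolations and means -/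

theorem divergence_add (u v : H10 Ω) :
    divergence (u + v) =ᵐ[volume.restrict Ω] divergence u + divergence v := by
  filter_upwards [Lp.coeFn_add (grad u) (grad v)] with x hx
  simp only [divergence, grad_add, hx, Pi.add_apply, PiLp.add_apply, Finset.sum_add_distrib]

theorem divergence_smul (c : ℝ) (u : H10 Ω) :
    divergence (c • u) =ᵐ[volume.restrict Ω] c • divergence u := by
  filter_upwards [Lp.coeFn_smul c (grad u)] with x hx
  simp only [divergence, grad_smul, hx, Pi.smul_apply, PiLp.smul_apply, Finset.smul_sum]

theorem divergence_zero : divergence (0 : H10 Ω) =ᵐ[volume.restrict Ω] 0 := by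
  have h := divergence_smul 0 (0 : H10 Ω)
  simpa using h

/-- The divergence free elements of `H¹₀`. -/
def divFree (Ω : Set (E d)) : Submodule ℝ (H10 Ω) where
  carrier := {u | divergence u =ᵐ[volume.restrict Ω] 0}
  zero_mem' := divergence_zero
  add_mem' {u v} hu hv := by
    have := (divergence_add u v).trans (Filter.EventuallyEq.add
      (show divergence u =ᵐ[volume.restrict Ω] 0 from hu) hv)
    simpa using this
  smul_mem' c u hu := by
    have := (divergence_smul c u).trans (Filter.EventuallyEq.const_smul
      (show divergence u =ᵐ[volume.restrict Ω] 0 from hu) c)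
    simpa using this

/-- The velocity space as a linear subspace. -/
def velocitySubmodule (𝒯 : Triangulation Ω) (k : ℕ) : Submodule ℝ (H10 Ω) where
  carrier := velocitySpace 𝒯 k
  zero_mem' i s _ := by
    refine ⟨0, by simp, ?_⟩
    filter_upwards [Lp.coeFn_zero (E d) 2 (volume.restrict Ω)] with x hx _
    rw [field_zero, hx]
    simp
  add_mem' {u v} hu hv i s hs := by
    obtain ⟨p, hp, hp'⟩ := hu i s hs
    obtain ⟨q, hq, hq'⟩ := hv i s hs
    refine ⟨p + q, (MvPolynomial.totalDegree_add p q).trans (max_le hp hq), ?_⟩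
    filter_upwards [hp', hq', Lp.coeFn_add (field u) (field v)] with x hx hx' hx'' hxs
    rw [field_add, hx'', map_add, ← hx hxs, ← hx' hxs]
    rfl
  smul_mem' c u hu i s hs := by
    obtain ⟨p, hp, hp'⟩ := hu i s hs
    refine ⟨c • p, (MvPolynomial.totalDegree_smul_le c p).trans hp, ?_⟩
    filter_upwards [hp', Lp.coeFn_smul c (field u)] with x hx hx' hxs
    rw [field_smul, hx', MvPolynomial.smul_eval, ← hx hxs]
    rfl

theorem field_extrap (u : ℕ → H10 Ω) (n : ℕ) :
    field (extrap u n) = (2 : ℝ) • field (u n) - field (u (n - 1)) := by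
  rw [extrap, field_sub, field_smul]

theorem extrap_mem {p : Submodule ℝ (H10 Ω)} {u : ℕ → H10 Ω} {n : ℕ} (h : u n ∈ p)
    (h' : u (n - 1) ∈ p) : extrap u n ∈ p :=
  p.sub_mem (p.smul_mem 2 h) h'

theorem ensembleMean_mem {p : Submodule ℝ (H10 Ω)} {J : ℕ} {u : Fin J → ℕ → H10 Ω} {n : ℕ}
    (h : ∀ j, extrap (u j) n ∈ p) : ensembleMean u n ∈ p :=
  p.smul_mem _ (p.sum_mem fun j _ => h j)

/-! ### The discrete energy estimate -/

/-- The energy identity of the second order backward difference formula. -/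
theorem inner_bdf2 {H : Type*} [NormedAddCommGroup H] [InnerProductSpace ℝ H] {t : ℝ} (ht : t ≠ 0)
    (x y z : H) :
    4 * t * inner ℝ ((1 / (2 * t)) • ((3 : ℝ) • x - (4 : ℝ) • y + z)) x =
      ‖x‖ ^ 2 + ‖(2 : ℝ) • x - y‖ ^ 2 - (‖y‖ ^ 2 + ‖(2 : ℝ) • y - z‖ ^ 2)
        + ‖x - ((2 : ℝ) • y - z)‖ ^ 2 := by
  simp only [← real_inner_self_eq_norm_sq, inner_sub_left, inner_sub_right, inner_add_left,
    inner_smul_left, inner_smul_right, RCLike.conj_to_real]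
  rw [real_inner_comm x y, real_inner_comm x z, real_inner_comm y z]
  field_simp
  ring

/-- The difference of the two sides is a square. The weight is α/3 because three terms share a
budget of α‖∇A‖²: cross viscosity, fluctuation and forcing. -/
theorem four_mul_le_young {α : ℝ} (hα : 0 < α) (x y : ℝ) :
    4 * (x * y) ≤ α / 3 * y ^ 2 + 12 / α * x ^ 2 := by
  have h : α / 3 * y ^ 2 + 12 / α * x ^ 2 - 4 * (x * y) = (α * y - 6 * x) ^ 2 / (3 * α) := by
    field_simp
    ring
  have : 0 ≤ (α * y - 6 * x) ^ 2 / (3 * α) := by positivity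
  linarith

theorem alpha_pos {ν νm : ℝ} (hν : 0 < ν) (hνm : 0 < νm) : 0 < alpha ν νm := by
  rw [alpha, sub_pos, abs_lt]
  constructor <;> linarith

/-- The energy `‖u^n‖² + ‖2 u^n - u^{n-1}‖²`. -/
def energy (u : ℕ → H10 Ω) (n : ℕ) : ℝ :=
  ‖field (u n)‖ ^ 2 + ‖(2 : ℝ) • field (u n) - field (u (n - 1))‖ ^ 2

/-- The energy estimate for one equation of the scheme. -/
theorem energy_step_le (hd : d = 2 ∨ d = 3) (hΩ : IsOpen Ω) (hb : Bornology.IsBounded Ω)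
    {C : ℝ} (hC : IsConvectionConstant Ω C) {𝒯 : Triangulation Ω} {k : ℕ} {r : ℝ}
    (hr : ∀ χ ∈ velocitySpace 𝒯 k, ‖grad χ‖ ≤ r * ‖field χ‖) {ν νm Δt : ℝ} (hν : 0 < ν)
    (hνm : 0 < νm) (hΔt : 0 < Δt) {J : ℕ} {f : HNeg Ω} {a c : Fin J → ℕ → H10 Ω} {j : Fin J}
    {n : ℕ} (hstep : IsStep (discreteDivFree 𝒯 k) ν νm Δt f a c j n)
    (ha0 : a j (n - 1) ∈ discreteDivFree 𝒯 k) (ha1 : a j n ∈ discreteDivFree 𝒯 k)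
    (ha2 : a j (n + 1) ∈ discreteDivFree 𝒯 k)
    (hc0 : ∀ i, c i (n - 1) ∈ discreteDivFree 𝒯 k) (hc1 : ∀ i, c i n ∈ discreteDivFree 𝒯 k)
    (hc2 : c j (n + 1) ∈ discreteDivFree 𝒯 k) {S : ℝ} (hS : ‖grad (fluctuation c j n)‖ ^ 2 ≤ S) :
    energy (a j) (n + 1) - energy (a j) n + ‖field (a j (n + 1) - extrap (a j) n)‖ ^ 2
        + 2 * Δt * (ν + νm) * ‖grad (a j (n + 1))‖ ^ 2
      ≤ Δt * |ν - νm| * (‖grad (a j (n + 1))‖ ^ 2 + ‖grad (c j (n + 1))‖ ^ 2)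
        + alpha ν νm * Δt * ‖grad (a j (n + 1))‖ ^ 2
        + Δt / alpha ν νm * (3 * (ν - νm) ^ 2 * r ^ 2)
          * ‖field (c j (n + 1) - extrap (c j) n)‖ ^ 2
        + Δt / alpha ν νm * (12 * C ^ 2 * r ^ 2 * S)
          * ‖field (a j (n + 1) - extrap (a j) n)‖ ^ 2
        + 12 * Δt / alpha ν νm * negNorm f ^ 2 := by
  have hα := alpha_pos hν hνm
  set α := alpha ν νm
  have hdf : ∀ u ∈ discreteDivFree 𝒯 k, u ∈ divFree Ω := fun u hu =>
    divergence_ae_eq_zero hΩ hb 𝒯 hu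
  have hvs : ∀ u ∈ discreteDivFree 𝒯 k, u ∈ velocitySubmodule 𝒯 k := fun u hu => hu.1
  have hext : ∀ i, extrap (c i) n ∈ divFree Ω := fun i =>
    extrap_mem (hdf _ (hc1 i)) (hdf _ (hc0 i))
  have hmean : ensembleMean c n ∈ divFree Ω := ensembleMean_mem hext
  have hfluc : fluctuation c j n ∈ divFree Ω := (divFree Ω).sub_mem (hext j) hmean
  set A := a j (n + 1) with hA
  set B := c j (n + 1) with hB
  set δa := A - extrap (a j) n with hδa
  set δc := B - extrap (c j) n with hδc
  have hδa_mem : δa ∈ velocitySubmodule 𝒯 k :=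
    Submodule.sub_mem _ (hvs _ ha2) (extrap_mem (hvs _ ha1) (hvs _ ha0))
  have hδc_mem : δc ∈ velocitySubmodule 𝒯 k :=
    Submodule.sub_mem _ (hvs _ hc2) (extrap_mem (hvs _ (hc1 j)) (hvs _ (hc0 j)))
  -- The extrapolation is replaced by A - δ so that the part with A in both last slots of b
  -- vanishes, leaving a factor δ.
  have ea : extrap (a j) n = A + (-1 : ℝ) • δa := by rw [hδa]; module
  have ec : extrap (c j) n = B + (-1 : ℝ) • δc := by rw [hδc]; module
  have h := hstep A ha2
  rw [← hA, b_self_eq_zero hd hb hmean, ea, b_add_mid hd hb, b_self_eq_zero hd hb hfluc,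
    b_smul_mid, ec, grad_add, grad_smul, inner_add_left, real_inner_smul_left (grad δc),
    real_inner_self_eq_norm_sq] at h
  have hbdf := inner_bdf2 hΔt.ne' (field A) (field (a j n)) (field (a j (n - 1)))
  rw [← field_extrap (a j), ← field_sub] at hbdf
  have hEn : energy (a j) n = ‖field (a j n)‖ ^ 2 + ‖field (extrap (a j) n)‖ ^ 2 := by
    rw [energy, field_extrap]
  have hEn1 : energy (a j) (n + 1) =
      ‖field A‖ ^ 2 + ‖(2 : ℝ) • field A - field (a j n)‖ ^ 2 := rfl
  set G := ‖grad A‖ with hG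
  set D := ν - νm
  set F := ‖grad (fluctuation c j n)‖
  have hG0 : 0 ≤ G := norm_nonneg _
  have h12 : 0 ≤ 12 / α := by positivity
  -- Split evenly between A and B, since the equation for the other unknown contributes the mirror
  -- image.
  have t1 : -2 * D * inner ℝ (grad B) (grad A) ≤ |D| * (G ^ 2 + ‖grad B‖ ^ 2) := by
    have h1 := abs_real_inner_le_norm (grad B) (grad A)
    have h2 : |inner ℝ (grad B) (grad A)| ≤ (G ^ 2 + ‖grad B‖ ^ 2) / 2 := by
      linarith [two_mul_le_add_sq ‖grad B‖ G]
    calc -2 * D * inner ℝ (grad B) (grad A) ≤ |-2 * D * inner ℝ (grad B) (grad A)| := le_abs_self _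
      _ = 2 * (|D| * |inner ℝ (grad B) (grad A)|) := by
        rw [abs_mul, abs_mul]
        norm_num
        ring
      _ ≤ 2 * (|D| * ((G ^ 2 + ‖grad B‖ ^ 2) / 2)) := by gcongr
      _ = _ := by ring
  -- Young with x = |D| r ‖δc‖ / 2: the half turns 12 into the 3 of the time step restriction.
  have t2 : 2 * D * inner ℝ (grad δc) (grad A) ≤
      α / 3 * G ^ 2 + 12 / α * (|D| * (r * ‖field δc‖) / 2) ^ 2 := by
    have h1 : |inner ℝ (grad δc) (grad A)| ≤ r * ‖field δc‖ * G :=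
      (abs_real_inner_le_norm _ _).trans (by gcongr; exact hr _ hδc_mem)
    calc 2 * D * inner ℝ (grad δc) (grad A) ≤ |2 * D * inner ℝ (grad δc) (grad A)| := le_abs_self _
      _ = 2 * (|D| * |inner ℝ (grad δc) (grad A)|) := by
        rw [abs_mul, abs_mul]
        norm_num
        ring
      _ ≤ 2 * (|D| * (r * ‖field δc‖ * G)) := by gcongr
      _ = 4 * (|D| * (r * ‖field δc‖) / 2 * G) := by ring
      _ ≤ _ := four_mul_le_young hα _ _
  have t3 : 4 * b (fluctuation c j n) δa A ≤
      α / 3 * G ^ 2 + 12 / α * (C ^ 2 * S * (r * ‖field δa‖) ^ 2) := by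
    have hC0 := hC.1
    calc 4 * b (fluctuation c j n) δa A ≤ 4 * (C * F * ‖grad δa‖ * G) := by
          gcongr
          exact (le_abs_self _).trans (hC.2 _ _ _)
      _ ≤ 4 * (C * F * (r * ‖field δa‖) * G) := by
          gcongr
          exact hr _ hδa_mem
      _ ≤ α / 3 * G ^ 2 + 12 / α * (C * F * (r * ‖field δa‖)) ^ 2 := four_mul_le_young hα _ _
      _ = α / 3 * G ^ 2 + 12 / α * (C ^ 2 * F ^ 2 * (r * ‖field δa‖) ^ 2) := by ring
      _ ≤ _ := by gcongr
  have t4 : 4 * f A ≤ α / 3 * G ^ 2 + 12 / α * negNorm f ^ 2 := by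
    have h1 := (le_abs_self _).trans (abs_apply_le_negNorm hd hb f A)
    linarith [four_mul_le_young hα (negNorm f) G]
  -- 4Δt times the tested equation, combined with the BDF2 identity.
  have key : energy (a j) (n + 1) - energy (a j) n + ‖field δa‖ ^ 2
      + 2 * Δt * (ν + νm) * G ^ 2 = Δt * (4 * f A + -2 * D * inner ℝ (grad B) (grad A)
        + 2 * D * inner ℝ (grad δc) (grad A) + 4 * b (fluctuation c j n) δa A) := by
    rw [hEn, hEn1]
    linear_combination 4 * Δt * h - hbdf
  have hsq : |D| ^ 2 = D ^ 2 := sq_abs D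
  rw [key]
  calc _ ≤ Δt * ((α / 3 * G ^ 2 + 12 / α * negNorm f ^ 2) + |D| * (G ^ 2 + ‖grad B‖ ^ 2)
        + (α / 3 * G ^ 2 + 12 / α * (|D| * (r * ‖field δc‖) / 2) ^ 2)
        + (α / 3 * G ^ 2 + 12 / α * (C ^ 2 * S * (r * ‖field δa‖) ^ 2))) := by gcongr
    _ = _ := by
      rw [← hsq]
      ring

theorem sum_energy_le {e g h : ℕ → ℝ} {M : ℕ} (hM : 1 ≤ M)
    (hstep : ∀ n ∈ Finset.Icc 1 (M - 1), e (n + 1) - e n + g n ≤ h n) :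
    e M + ∑ n ∈ Finset.Icc 1 (M - 1), g n ≤ e 1 + ∑ n ∈ Finset.Icc 1 (M - 1), h n := by
  induction M, hM using Nat.le_induction with
  | base => simp
  | succ m hm ih =>
    have h1 := ih fun n hn => hstep n (by simp only [Finset.mem_Icc] at hn ⊢; omega)
    have h2 := hstep m (by simp; omega)
    obtain ⟨l, rfl⟩ : ∃ l, m = l + 1 := ⟨m - 1, by omega⟩
    simp only [Nat.add_sub_cancel] at h1 ⊢
    rw [Finset.sum_Icc_succ_top (by omega), Finset.sum_Icc_succ_top (by omega)]
    linarith

/-- The energy estimate for the coupled scheme under the time step restriction. -/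
theorem energy_pair_step_le (hd : d = 2 ∨ d = 3) (hΩ : IsOpen Ω) (hb : Bornology.IsBounded Ω)
    {C : ℝ} (hC : IsConvectionConstant Ω C) {𝒯 : Triangulation Ω} {k : ℕ} {Ci : ℝ}
    (hinv : InverseInequality 𝒯 k Ci) {ν νm Δt : ℝ} (hν : 0 < ν) (hνm : 0 < νm) (hΔt : 0 < Δt)
    {M J : ℕ} {f₁ f₂ : Fin J → ℝ → HNeg Ω} {v w : Fin J → ℕ → H10 Ω}
    (hsol : IsEnsembleSolution 𝒯 k ν νm Δt M f₁ f₂ v w)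
    (hres : TimeStepRestriction ν νm C Ci 𝒯.meshSize Δt M v w) (j : Fin J) {n : ℕ}
    (hn : n ∈ Finset.Icc 1 (M - 1)) :
    (energy (v j) (n + 1) + energy (w j) (n + 1)) - (energy (v j) n + energy (w j) n)
        + alpha ν νm * Δt * (‖grad (v j (n + 1))‖ ^ 2 + ‖grad (w j (n + 1))‖ ^ 2)
      ≤ 12 * Δt / alpha ν νm * (negNorm (f₁ j ((n + 1 : ℕ) * Δt)) ^ 2
        + negNorm (f₂ j ((n + 1 : ℕ) * Δt)) ^ 2) := by
  have hα := alpha_pos hν hνm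
  have hn' := Finset.mem_Icc.1 hn
  set S : ℝ := ⨆ j, max (‖grad (fluctuation v j n)‖ ^ 2) (‖grad (fluctuation w j n)‖ ^ 2) with hSdef
  have hS : max (‖grad (fluctuation v j n)‖ ^ 2) (‖grad (fluctuation w j n)‖ ^ 2) ≤ S :=
    le_ciSup (f := fun j => max (‖grad (fluctuation v j n)‖ ^ 2) (‖grad (fluctuation w j n)‖ ^ 2))
      (Set.finite_range _).bddAbove j
  set r := Ci / 𝒯.meshSize with hr
  -- This is the total coefficient of each ‖δ‖² after adding the equations: the first part comes
  -- from the other equation, the second from its own.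
  have hcoef : Δt / alpha ν νm * (3 * (ν - νm) ^ 2 * r ^ 2 + 12 * C ^ 2 * r ^ 2 * S) ≤ 1 := by
    rw [div_mul_eq_mul_div, div_le_one hα]
    -- If h = 0, division by zero gives r = 0 and the coefficient vanishes.
    rcases eq_or_ne 𝒯.meshSize 0 with h0 | h0
    · simp [hr, h0, hα.le]
    · have h := hres n hn
      rw [← hSdef] at h
      have hpos : 0 < 𝒯.meshSize ^ 2 := by positivity
      rw [← div_le_iff₀ hpos] at h
      refine le_trans (le_of_eq ?_) h
      rw [hr]
      ring
  have hv := fun i => hsol.mem_v i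
  have hw := fun i => hsol.mem_w i
  have e1 := energy_step_le hd hΩ hb hC hinv hν hνm hΔt (hsol.step_v j n hn)
    (hv j _ (by omega)) (hv j _ (by omega)) (hv j _ (by omega)) (fun i => hw i _ (by omega))
    (fun i => hw i _ (by omega)) (hw j _ (by omega)) ((le_max_right _ _).trans hS)
  have e2 := energy_step_le hd hΩ hb hC hinv hν hνm hΔt (hsol.step_w j n hn)
    (hw j _ (by omega)) (hw j _ (by omega)) (hw j _ (by omega)) (fun i => hv i _ (by omega))
    (fun i => hv i _ (by omega)) (hv j _ (by omega)) ((le_max_left _ _).trans hS)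
  have m1 := mul_le_mul_of_nonneg_right hcoef
    (sq_nonneg ‖field (v j (n + 1) - extrap (v j) n)‖)
  have m2 := mul_le_mul_of_nonneg_right hcoef
    (sq_nonneg ‖field (w j (n + 1) - extrap (w j) n)‖)
  have hαd : alpha ν νm = ν + νm - |ν - νm| := rfl
  -- Viscous balance per squared gradient: of 2Δt(ν + ν_m), the two cross terms take 2Δt|ν - ν_m|
  -- and Young takes αΔt, which leaves αΔt.
  have habs : |ν - νm| = ν + νm - alpha ν νm := by linarith
  rw [habs] at e1 e2
  linarith

end MHDEnsemble

end

theorem mainTheorem1 (d : ℕ) (hd : d = 2 ∨ d = 3) (Ω : Set (MHDEnsemble.E d))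
    (hΩ_open : IsOpen Ω) (hΩ_convex : Convex ℝ Ω) (hΩ_bounded : Bornology.IsBounded Ω)
    (hΩ_nonempty : Ω.Nonempty) :
    (∃ C : ℝ, MHDEnsemble.IsConvectionConstant Ω C) ∧
    ∀ (C : ℝ), MHDEnsemble.IsConvectionConstant Ω C →
    ∀ (𝒯 : MHDEnsemble.Triangulation Ω) (k : ℕ), 1 ≤ k →
    ∀ (Ci : ℝ), 0 < Ci → MHDEnsemble.InverseInequality 𝒯 k Ci →
    ∀ (ν νm : ℝ), 0 < ν → 0 < νm →
    ∀ (T Δt : ℝ) (M : ℕ), 0 < T → 0 < Δt → (M : ℝ) = T / Δt →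
    ∀ (J : ℕ) (f₁ f₂ : Fin J → ℝ → MHDEnsemble.HNeg Ω)
      (v w : Fin J → ℕ → MHDEnsemble.H10 Ω),
    MHDEnsemble.IsEnsembleSolution 𝒯 k ν νm Δt M f₁ f₂ v w →
    MHDEnsemble.TimeStepRestriction ν νm C Ci 𝒯.meshSize Δt M v w →
    0 < MHDEnsemble.alpha ν νm ∧
    ∀ j : Fin J,
      ‖MHDEnsemble.field (v j M)‖ ^ 2 + ‖MHDEnsemble.field (w j M)‖ ^ 2
        + ‖(2 : ℝ) • MHDEnsemble.field (v j M) - MHDEnsemble.field (v j (M - 1))‖ ^ 2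
        + ‖(2 : ℝ) • MHDEnsemble.field (w j M) - MHDEnsemble.field (w j (M - 1))‖ ^ 2
        + MHDEnsemble.alpha ν νm * Δt * ∑ n ∈ Finset.Icc 1 (M - 1),
            (‖MHDEnsemble.grad (v j (n + 1))‖ ^ 2 + ‖MHDEnsemble.grad (w j (n + 1))‖ ^ 2)
      ≤ ‖MHDEnsemble.field (v j 1)‖ ^ 2 + ‖MHDEnsemble.field (w j 1)‖ ^ 2
        + ‖(2 : ℝ) • MHDEnsemble.field (v j 1) - MHDEnsemble.field (v j 0)‖ ^ 2
        + ‖(2 : ℝ) • MHDEnsemble.field (w j 1) - MHDEnsemble.field (w j 0)‖ ^ 2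
        + 12 * Δt / MHDEnsemble.alpha ν νm * ∑ n ∈ Finset.Icc 1 (M - 1),
            (MHDEnsemble.negNorm (f₁ j ((n + 1 : ℕ) * Δt)) ^ 2
              + MHDEnsemble.negNorm (f₂ j ((n + 1 : ℕ) * Δt)) ^ 2) := by

  refine ⟨MHDEnsemble.exists_isConvectionConstant hd hΩ_bounded, ?_⟩
  intro C hC 𝒯 k _ Ci _ hinv ν νm hν hνm T Δt M hT hΔt hMT J f₁ f₂ v w hsol hres
  refine ⟨MHDEnsemble.alpha_pos hν hνm, fun j => ?_⟩
  -- T > 0 excludes M = 0, for which M - 1 would be truncated and the telescoped sum could not start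
  -- at n = 1.
  have hM : 1 ≤ M := by
    have h : (0 : ℝ) < M := hMT ▸ div_pos hT hΔt
    exact_mod_cast h
  have h := MHDEnsemble.sum_energy_le
    (e := fun n => MHDEnsemble.energy (v j) n + MHDEnsemble.energy (w j) n) hM fun n hn =>
      MHDEnsemble.energy_pair_step_le hd hΩ_open hΩ_bounded hC hinv hν hνm hΔt hsol hres j hn
  simp only [← Finset.mul_sum, MHDEnsemble.energy, Nat.sub_self] at h
  linarith
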